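/- Let $G$ be a finite group and $k$ a field. All $kG$-modules below are finitely generated left modules. Let $\mathrm{stmod}(kG)$ be the stable module category: its objects are the $kG$-modules, and $\underline{\mathrm{Hom}}_{kG}(X,Y)$ is $\mathrm{Hom}_{kG}(X,Y)$ modulo the maps that factor through a projective module. For a module $X$ let $\Omega X$ be the kernel of a surjection from a projective module onto $X$ and $\Omega^{-1}X$ the cokernel of an embedding of $X$ into a projective module (both are well defined up to isomorphism in $\mathrm{stmod}(kG)$), let $\Omega^i$, $i\in\mathbb Z$, be the iterates, and put $\widehat{\mathrm{Ext}}{}^i_{kG}(X,Y)=\underline{\mathrm{Hom}}_{kG}(\Omega^iX,Y)$. A short exact sequence $0\to A\to B\to C\to 0$ of modules is almost split if $A$ and $C$ are indecomposable, it does not split, and every map $X\to C$ that is not a split epimorphism factors through $B\to C$. **Theorem 2.1.** Let $M$ and $N$ be non-projective indecomposable $kG$-modules such that $N\not\cong\Omega^iM$ in $\mathrm{stmod}(kG)$ for every $i\in\mathbb Z$. Then there is a map $\varphi\colon N\to\Omega N$ in $\mathrm{stmod}(kG)$ which is a connecting map of an almost split sequence ending in $N$; that is, there is an almost split sequence $0\to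 A\to B\to N\to 0$ with an isomorphism $\psi\colon\Omega^{-1}A\cong\Omega N$ in $\mathrm{stmod}(kG)$, and $\varphi=\psi\circ\delta$, where $A\to B\to N\xrightarrow{\ \delta\ }\Omega^{-1}A$ is the distinguished triangle in $\mathrm{stmod}(kG)$ defined by the sequence. Moreover, every such $\varphi$ is nonzero in $\mathrm{stmod}(kG)$, and for every $i\in\mathbb Z$ the induced map $$\varphi_*\colon\widehat{\mathrm{Ext}}{}^i_{kG}(M,N)\longrightarrow\widehat{\mathrm{Ext}}{}^i_{kG}(M,\Omega N)$$ is zero. -/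

import Mathlib

open CategoryTheory TensorProduct

universe u

noncomputable section

namespace StableModule

/-! ### The stable category of finitely generated modules -/

section StableCategory

variable (R : Type u) [Ring R]

/-- Two maps of finitely generated modules are stably equal if their difference factors through a
finitely generated projective module. -/
def stableRel : HomRel (FGModuleCat.{u} R) := fun X Y f g =>
  ∃ P : FGModuleCat.{u} R, Module.Projective R P ∧ ∃ (a : X ⟶ P) (b : P ⟶ Y), f - g = a ≫ b

theorem stableRel_add ⦃X Y : FGModuleCat.{u} R⦄ (f₁ f₂ g₁ g₂ : X ⟶ Y)
    (h₁ : stableRel R f₁ f₂) (h₂ : stableRel R g₁ g₂) :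
    stableRel R (f₁ + g₁) (f₂ + g₂) := by
  obtain ⟨P, hP, a, b, h⟩ := h₁
  obtain ⟨Q, hQ, c, d, h'⟩ := h₂
  refine ⟨FGModuleCat.of R (P × Q), ?_,
    FGModuleCat.ofHom (a.hom.hom.prod c.hom.hom),
    FGModuleCat.ofHom (b.hom.hom.coprod d.hom.hom), ?_⟩
  · change Module.Projective R (P × Q)
    infer_instance
  · have e : f₁ + g₁ - (f₂ + g₂) = a ≫ b + c ≫ d := by rw [← h, ← h']; abel
    rw [e]
    ext x
    rfl

instance : Congruence (stableRel R) where
  comp_left f _ _ := by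
    rintro ⟨P, hP, a, b, h⟩
    exact ⟨P, hP, f ≫ a, b, by rw [← Preadditive.comp_sub, h, Category.assoc]⟩
  comp_right g := by
    rintro ⟨P, hP, a, b, h⟩
    exact ⟨P, hP, a, b ≫ g, by rw [← Preadditive.sub_comp, h, Category.assoc]⟩
  equivalence {X Y} :=
    { refl := fun f => by
        refine ⟨FGModuleCat.of R PUnit, ?_, 0, 0, by simp⟩
        change Module.Projective R PUnit.{u + 1}
        infer_instance
      symm := by
        rintro f g ⟨P, hP, a, b, h⟩
        exact ⟨P, hP, -a, b, by rw [Preadditive.neg_comp, ← h, neg_sub]⟩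
      trans := by
        intro f g l h₁ h₂
        have h := stableRel_add R _ _ _ _ h₁ h₂
        obtain ⟨P, hP, a, b, h⟩ := h
        exact ⟨P, hP, a, b, by rw [← h]; abel⟩ }

/-- The stable module category `stmod R`: finitely generated modules, with maps taken modulo the
maps that factor through a projective module. -/
abbrev StMod := Quotient (stableRel R)

instance : Preadditive (StMod R) := Quotient.preadditive _ (stableRel_add R)

/-- The quotient functor from finitely generated modules to the stable module category. -/
abbrev toStMod : FGModuleCat.{u} R ⥤ StMod R := Quotient.functor _

/-- A linear map of finitely generated modules as a morphism of the category. -/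
abbrev mkHom {R : Type u} [Ring R] {X Y : FGModuleCat.{u} R} (f : X →ₗ[R] Y) : X ⟶ Y :=
  ObjectProperty.homMk (ModuleCat.ofHom f)

/-- A module is indecomposable if it is nonzero and is not an internal direct sum of two nonzero
submodules. -/
def IsIndecomposable (M : Type u) [AddCommGroup M] [Module R M] : Prop :=
  Nontrivial M ∧ ∀ U V : Submodule R M, IsCompl U V → U = ⊥ ∨ V = ⊥

variable {R}

/-- A short exact sequence `0 ⟶ A ⟶ B ⟶ C ⟶ 0` of finitely generated modules with prescribed last
term `C`. -/
structure SES (C : FGModuleCat.{u} R) where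
  A : FGModuleCat.{u} R
  B : FGModuleCat.{u} R
  inc : A →ₗ[R] B
  proj : B →ₗ[R] C
  injective : Function.Injective inc
  exact : Function.Exact inc proj
  surjective : Function.Surjective proj

/-- Almost split (Auslander–Reiten) sequences: the end terms are indecomposable, the sequence does
not split, and each map to `C` which is not a split epimorphism factors through `B`. -/
structure SES.IsAlmostSplit {C : FGModuleCat.{u} R} (E : SES C) : Prop where
  left : IsIndecomposable R E.A
  right : IsIndecomposable R C
  nonsplit : ¬ ∃ s : C →ₗ[R] E.B, E.proj ∘ₗ s = LinearMap.id
  lift : ∀ (X : FGModuleCat.{u} R) (f : X →ₗ[R] C),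
    (¬ ∃ s : C →ₗ[R] X, f ∘ₗ s = LinearMap.id) → ∃ g : X →ₗ[R] E.B, E.proj ∘ₗ g = f

end StableCategory

/-! ### The module `kG ⊗ M` with its two canonical maps -/

section Free

variable {k G : Type u} [Field k] [Group G]

variable {M : Type u} [AddCommGroup M] [Module k M] [Fintype G]
variable {B : Type u} [AddCommGroup B] [Module k B] [Module (MonoidAlgebra k G) B]
  [IsScalarTower k (MonoidAlgebra k G) B]

/-- The `kG`-linear map `B ⟶ kG ⊗ M`, `x ↦ ∑ g, g ⊗ r (g⁻¹ x)`, attached to a `k`-linear map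
`r : B ⟶ M`. -/
def coextend (r : B →ₗ[k] M) : B →ₗ[MonoidAlgebra k G] MonoidAlgebra k G ⊗[k] M :=
  MonoidAlgebra.equivariantOfLinearOfComm
    { toFun := fun x => ∑ g : G, MonoidAlgebra.single g (1 : k) ⊗ₜ[k]
        r (MonoidAlgebra.single g⁻¹ (1 : k) • x)
      map_add' := fun x y => by simp [smul_add, tmul_add, Finset.sum_add_distrib]
      map_smul' := fun c x => by
        simp only [RingHom.id_apply, Finset.smul_sum]
        refine Finset.sum_congr rfl fun g _ => ?_
        rw [smul_comm, map_smul, tmul_smul] }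
    (fun h x => by
      simp only [LinearMap.coe_mk, AddHom.coe_mk, Finset.smul_sum]
      refine Fintype.sum_equiv (Equiv.mulLeft h⁻¹) _ _ fun g => ?_
      simp [smul_tmul', ← mul_smul, MonoidAlgebra.single_mul_single])

theorem coextend_apply (r : B →ₗ[k] M) (x : B) :
    coextend r x = ∑ g : G, MonoidAlgebra.single g (1 : k) ⊗ₜ[k]
        r (MonoidAlgebra.single g⁻¹ (1 : k) • x) := rfl

end Free

section Maps

variable {k G : Type u} [Field k] [Group G]
  (M : Type u) [AddCommGroup M] [Module k M] [Module (MonoidAlgebra k G) M]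
  [IsScalarTower k (MonoidAlgebra k G) M]

/-- The surjection `kG ⊗ M ⟶ M`, `a ⊗ m ↦ a m`, from a free module (`G` acts on the left factor). -/
def counit : MonoidAlgebra k G ⊗[k] M →ₗ[MonoidAlgebra k G] M :=
  AlgebraTensorModule.lift
    { toFun := fun a => Module.toModuleEnd k (S := MonoidAlgebra k G) M a
      map_add' := fun a b => by ext m; simp [add_smul]
      map_smul' := fun a b => by ext m; simp [mul_smul] }

@[simp]
theorem counit_tmul (a : MonoidAlgebra k G) (m : M) : counit M (a ⊗ₜ[k] m) = a • m := rfl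

/-- The injection `M ⟶ kG ⊗ M`, `m ↦ ∑ g, g ⊗ g⁻¹ m`, into a free (hence injective) module. -/
def unit [Fintype G] : M →ₗ[MonoidAlgebra k G] MonoidAlgebra k G ⊗[k] M := coextend LinearMap.id

end Maps

/-! ### Syzygies, connecting maps and Tate cohomology -/

section Group

variable {k G : Type u} [Field k] [Group G] [Fintype G]

attribute [local instance] ModuleCat.moduleOfAlgebraModule
  ModuleCat.isScalarTower_of_algebra_moduleCat

instance : Module.Finite k (MonoidAlgebra k G) :=
  Module.Finite.equiv (MonoidAlgebra.coeffLinearEquiv (S := k) (M := G) k).symm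

instance : IsNoetherianRing (MonoidAlgebra k G) :=
  isNoetherian_of_tower k (inferInstance : IsNoetherian k (MonoidAlgebra k G))

instance (M : FGModuleCat.{u} (MonoidAlgebra k G)) :
    Module.Finite (MonoidAlgebra k G) (MonoidAlgebra k G ⊗[k] M) :=
  have : Module.Finite k M := Module.Finite.trans (MonoidAlgebra k G) M
  inferInstance

/-- `Ω M`: the kernel of the surjection `kG ⊗ M ⟶ M` from a free module. -/
def Omega (M : FGModuleCat.{u} (MonoidAlgebra k G)) : FGModuleCat.{u} (MonoidAlgebra k G) :=
  FGModuleCat.of _ (LinearMap.ker (counit (k := k) (G := G) M))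

/-- `Ω⁻¹ M`: the cokernel of the injection `M ⟶ kG ⊗ M` into a free module. -/
def OmegaInv (M : FGModuleCat.{u} (MonoidAlgebra k G)) : FGModuleCat.{u} (MonoidAlgebra k G) :=
  FGModuleCat.of _
    ((MonoidAlgebra k G ⊗[k] M) ⧸ LinearMap.range (unit (k := k) (G := G) M))

/-- `Ω^i M` for all integers `i`. -/
def OmegaPow : ℤ → FGModuleCat.{u} (MonoidAlgebra k G) → FGModuleCat.{u} (MonoidAlgebra k G)
  | Int.ofNat n => Omega^[n]
  | Int.negSucc n => OmegaInv^[n + 1]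

/-- The identity of `A` extends to a map from the sequence `0 ⟶ A ⟶ B ⟶ C ⟶ 0` to the sequence
`0 ⟶ A ⟶ kG ⊗ A ⟶ Ω⁻¹ A ⟶ 0`. -/
theorem SES.exists_connecting {C : FGModuleCat.{u} (MonoidAlgebra k G)} (E : SES C) :
    ∃ (δ : C →ₗ[MonoidAlgebra k G] OmegaInv E.A)
      (b : E.B →ₗ[MonoidAlgebra k G] MonoidAlgebra k G ⊗[k] E.A),
      b ∘ₗ E.inc = unit E.A ∧
      δ ∘ₗ E.proj = (LinearMap.range (unit (k := k) (G := G) E.A)).mkQ ∘ₗ b := by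
  obtain ⟨r, hr⟩ := (E.inc.restrictScalars k).exists_leftInverse_of_injective
    (LinearMap.ker_eq_bot.2 E.injective)
  have hb : coextend r ∘ₗ E.inc = unit (k := k) (G := G) E.A := by
    ext x
    simp only [LinearMap.comp_apply, unit, coextend_apply]
    refine Finset.sum_congr rfl fun g _ => ?_
    rw [← map_smul E.inc]
    exact congrArg _ (LinearMap.congr_fun hr _)
  let q := (LinearMap.range (unit (k := k) (G := G) E.A)).mkQ ∘ₗ coextend r
  have hq : LinearMap.ker E.proj ≤ LinearMap.ker q := by
    intro x hx
    obtain ⟨a, rfl⟩ := (E.exact x).1 hx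
    have := LinearMap.congr_fun hb a
    simp only [LinearMap.comp_apply] at this
    simp [q, this]
  refine ⟨(LinearMap.ker E.proj).liftQ q hq ∘ₗ
    (E.proj.quotKerEquivOfSurjective E.surjective).symm.toLinearMap, coextend r, hb, ?_⟩
  ext x
  have : (E.proj.quotKerEquivOfSurjective E.surjective).symm (E.proj x)
      = (LinearMap.ker E.proj).mkQ x := by
    rw [LinearEquiv.symm_apply_eq]; rfl
  simp only [LinearMap.comp_apply, LinearEquiv.coe_coe, this]
  rfl

/-- The third map of the distinguished triangle `A ⟶ B ⟶ C ⟶ Ω⁻¹ A` in the stable category that is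
attached to a short exact sequence `0 ⟶ A ⟶ B ⟶ C ⟶ 0`: the map on cokernels induced by any
extension of the identity of `A` to a map from that sequence to `0 ⟶ A ⟶ kG ⊗ A ⟶ Ω⁻¹ A ⟶ 0`
(two extensions give the same map in the stable category). -/
def SES.connecting {C : FGModuleCat.{u} (MonoidAlgebra k G)} (E : SES C) :
    (toStMod _).obj C ⟶ (toStMod _).obj (OmegaInv E.A) :=
  (toStMod (MonoidAlgebra k G)).map (mkHom E.exists_connecting.choose)

/-- The connecting map does not depend on the chosen extension. -/
theorem SES.connecting_eq {C : FGModuleCat.{u} (MonoidAlgebra k G)} (E : SES C)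
    (δ : C →ₗ[MonoidAlgebra k G] OmegaInv E.A)
    (b : E.B →ₗ[MonoidAlgebra k G] MonoidAlgebra k G ⊗[k] E.A)
    (hb : b ∘ₗ E.inc = unit E.A)
    (hδ : δ ∘ₗ E.proj = (LinearMap.range (unit (k := k) (G := G) E.A)).mkQ ∘ₗ b) :
    (toStMod (MonoidAlgebra k G)).map (mkHom δ) = E.connecting := by
  obtain ⟨b', hb', hδ'⟩ := E.exists_connecting.choose_spec
  unfold SES.connecting
  set δ' := E.exists_connecting.choose
  have hk : LinearMap.ker E.proj ≤ LinearMap.ker (b - b') := by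
    intro x hx
    obtain ⟨a, rfl⟩ := (E.exact x).1 hx
    have h1 := LinearMap.congr_fun hb a
    have h2 := LinearMap.congr_fun hb' a
    simp only [LinearMap.comp_apply] at h1 h2
    simp [h1, h2]
  let h := (LinearMap.ker E.proj).liftQ (b - b') hk ∘ₗ
    (E.proj.quotKerEquivOfSurjective E.surjective).symm.toLinearMap
  have hh : ∀ x, h (E.proj x) = b x - b' x := by
    intro x
    have : (E.proj.quotKerEquivOfSurjective E.surjective).symm (E.proj x)
        = (LinearMap.ker E.proj).mkQ x := by
      rw [LinearEquiv.symm_apply_eq]; rfl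
    simp only [h, LinearMap.comp_apply, LinearEquiv.coe_coe, this]
    rfl
  refine (Quotient.functor_map_eq_iff _ _ _).2 ⟨FGModuleCat.of _ (MonoidAlgebra k G ⊗[k] E.A), ?_, mkHom h,
    mkHom (Y := OmegaInv E.A) (LinearMap.range (unit (k := k) (G := G) E.A)).mkQ, ?_⟩
  · change Module.Projective (MonoidAlgebra k G) (MonoidAlgebra k G ⊗[k] E.A)
    infer_instance
  · ext y
    obtain ⟨x, rfl⟩ := E.surjective y
    change δ (E.proj x) - δ' (E.proj x) =
      (LinearMap.range (unit (k := k) (G := G) E.A)).mkQ (h (E.proj x))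
    rw [hh, map_sub]
    exact congrArg₂ (· - ·) (LinearMap.congr_fun hδ x) (LinearMap.congr_fun hδ' x)

/-- `φ : N ⟶ Ω N` is a connecting map of an almost split sequence `0 ⟶ A ⟶ B ⟶ N ⟶ 0`; here `A`
is the second syzygy of `N`, so that `Ω⁻¹ A` is identified with `Ω N` in the stable category. -/
def IsAlmostSplitConnecting (N : FGModuleCat.{u} (MonoidAlgebra k G))
    (φ : (toStMod _).obj N ⟶ (toStMod _).obj (Omega N)) : Prop :=
  ∃ E : SES N, E.IsAlmostSplit ∧
    ∃ ψ : (toStMod _).obj (OmegaInv E.A) ≅ (toStMod _).obj (Omega N), φ = E.connecting ≫ ψ.hom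

/-- The Tate Ext group in degree `i`: the stable maps from `Ω^i M` to `X`. -/
abbrev TateExt (i : ℤ) (M : FGModuleCat.{u} (MonoidAlgebra k G))
    (X : StMod (MonoidAlgebra k G)) : Type u :=
  (toStMod _).obj (OmegaPow i M) ⟶ X

/-- The map on Tate Ext groups induced by a stable map in the second variable. -/
def TateExt.map (i : ℤ) (M : FGModuleCat.{u} (MonoidAlgebra k G))
    {X Y : StMod (MonoidAlgebra k G)} (φ : X ⟶ Y) : TateExt i M X →+ TateExt i M Y :=
  Preadditive.rightComp _ φ

end Group

end StableModule

end

noncomputable section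

namespace StableModule

/-! ### The trace pairing -/

section TracePairing

variable {k X Y : Type*} [Field k] [AddCommGroup X] [Module k X] [Module.Finite k X]
  [AddCommGroup Y] [Module k Y]

/-! Vanishing: if `f : Ω^i M ⟶ N` is not a split epimorphism, it lifts to `B`, and `B ⟶ N ⟶ Ω⁻¹A` is
stably zero. If `f` were split by `s`, then `s ∘ f` would be a stable idempotent of `Ω^i M`; these
are trivial and `N` is not projective, so `N` would be stably isomorphic to `Ω^i M`. The connecting
map is nonzero because a sequence whose connecting map is stably zero splits.

Existence rests on an explicit form of Tate duality. Linear maps `X ⟶ N` of zero norm induce maps `X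
⟶ Ω N`. Such a map is stably zero if the linear map is trace orthogonal to all equivariant maps `N ⟶
X` (`factorsThroughProjective_toOmega`); for `X = N`, being stably zero forces trace zero
(`trace_eq_zero_of_factorsThroughProjective`). Since `End N` is local, some functional kills its
non-units but not the identity; it is the trace form of some `ρ`, which yields `δ : N ⟶ Ω N`, not
stably zero, with `δ ∘ f` stably zero whenever `f` is not a split epimorphism. Pulling back along
`δ` a projective presentation of `Ω N` with indecomposable kernel gives the almost split sequence.
-/

theorem trace_comp_dualTensorHom (g : Y →ₗ[k] X) (ξ : Module.Dual k X) (y : Y) :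
    LinearMap.trace k X (g ∘ₗ dualTensorHom k X Y (ξ ⊗ₜ y)) = ξ (g y) := by
  have h : g ∘ₗ dualTensorHom k X Y (ξ ⊗ₜ y) = dualTensorHom k X X (ξ ⊗ₜ g y) := by
    ext x
    simp
  rw [h, LinearMap.trace_eq_contract_apply, contractLeft_apply]

/-- Every functional on `Hom(X, Y)` is the trace pairing with some map `Y ⟶ X`. -/
theorem exists_trace_comp_eq (μ : (X →ₗ[k] Y) →ₗ[k] k) :
    ∃ g : Y →ₗ[k] X, ∀ u, LinearMap.trace k X (g ∘ₗ u) = μ u := by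
  -- For fixed `y`, `ξ ↦ μ (ξ ⊗ y)` lies in the double dual of `X`; `g y` is the vector representing
  -- it.
  let g : Y →ₗ[k] X := (Module.evalEquiv k X).symm.toLinearMap ∘ₗ
    (TensorProduct.curry (μ ∘ₗ dualTensorHom k X Y)).flip
  refine ⟨g, fun u => ?_⟩
  obtain ⟨t, rfl⟩ := (dualTensorHomEquiv k X Y).surjective u
  change LinearMap.trace k X (g ∘ₗ dualTensorHom k X Y t) = μ (dualTensorHom k X Y t)
  induction t with
  | zero => simp
  | add a b ha hb => rw [map_add, LinearMap.comp_add, map_add, map_add, ha, hb]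
  | tmul ξ y =>
    rw [trace_comp_dualTensorHom]
    simp [g]

/-- The trace pairing is nondegenerate. -/
theorem eq_zero_of_trace_comp_eq_zero (g : Y →ₗ[k] X)
    (h : ∀ u : X →ₗ[k] Y, LinearMap.trace k X (g ∘ₗ u) = 0) : g = 0 := by
  ext y
  refine (Module.forall_dual_apply_eq_zero_iff k (g y)).1 fun ξ => ?_
  rw [← trace_comp_dualTensorHom, h]

end TracePairing

/-! ### The action of `G` on linear maps -/

section Conjugation

variable {k G : Type u} [Field k] [Group G]
  {X : Type u} [AddCommGroup X] [Module k X] [Module (MonoidAlgebra k G) X]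
  [IsScalarTower k (MonoidAlgebra k G) X]
  {Y : Type u} [AddCommGroup Y] [Module k Y] [Module (MonoidAlgebra k G) Y]
  [IsScalarTower k (MonoidAlgebra k G) Y]

theorem conjugate_add (u v : X →ₗ[k] Y) (h : G) :
    (u + v).conjugate h = u.conjugate h + v.conjugate h := by
  ext x
  simp [LinearMap.conjugate_apply]

theorem conjugate_smul (c : k) (u : X →ₗ[k] Y) (h : G) :
    (c • u).conjugate h = c • u.conjugate h := by
  rw [LinearMap.conjugate, LinearMap.conjugate, LinearMap.smul_comp, LinearMap.comp_smul]

theorem conjugate_one (u : X →ₗ[k] Y) : u.conjugate (1 : G) = u := by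
  ext x
  simp [LinearMap.conjugate_apply, ← MonoidAlgebra.one_def]

/-- Cyclicity of the trace: conjugations by `h` and `h⁻¹` are adjoint for the trace pairing. -/
theorem trace_comp_conjugate [Module.Finite k X] [Module.Finite k Y] (u : X →ₗ[k] Y) (g : Y →ₗ[k] X) (h : G) :
    LinearMap.trace k X (g ∘ₗ u.conjugate h) = LinearMap.trace k X (g.conjugate h⁻¹ ∘ₗ u) := by
  rw [LinearMap.conjugate, LinearMap.conjugate, inv_inv, ← LinearMap.comp_assoc,
    ← LinearMap.comp_assoc, LinearMap.trace_comp_comm', ← LinearMap.comp_assoc,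
    ← LinearMap.comp_assoc, LinearMap.comp_assoc]

/-- A linear map is equivariant if it is fixed by conjugation. -/
def equivariantOfConjugate (g : X →ₗ[k] Y) (hg : ∀ h : G, g.conjugate h = g) :
    X →ₗ[MonoidAlgebra k G] Y :=
  MonoidAlgebra.equivariantOfLinearOfComm g fun h x => by
    have := LinearMap.congr_fun (hg h) x
    rw [LinearMap.conjugate_apply] at this
    rw [← this, ← mul_smul, MonoidAlgebra.single_mul_single]
    simp [← MonoidAlgebra.one_def]

/-- A linear map which is trace orthogonal to all equivariant maps is a sum of conjugates
of maps whose sum is zero. -/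
theorem exists_sum_conjugate_of_trace_eq_zero [Fintype G] [Module.Finite k X] [Module.Finite k Y]
    (v : X →ₗ[k] Y)
    (hv : ∀ g : Y →ₗ[MonoidAlgebra k G] X,
      LinearMap.trace k X (g.restrictScalars k ∘ₗ v) = 0) :
    ∃ w : G → (X →ₗ[k] Y), ∑ h, w h = 0 ∧ ∑ h, (w h).conjugate h = v := by
  classical
  -- `W` is the span of the differences `u.conjugate h - u`; the families `w` are the form from
  -- which a factorization through a projective is built later.
  let W : Submodule k (X →ₗ[k] Y) :=
    { carrier := {v | ∃ w : G → (X →ₗ[k] Y), ∑ h, w h = 0 ∧ ∑ h, (w h).conjugate h = v}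
      zero_mem' := ⟨0, by simp, by ext; simp [LinearMap.conjugate_apply]⟩
      add_mem' := by
        rintro _ _ ⟨w, hw, rfl⟩ ⟨w', hw', rfl⟩
        exact ⟨w + w', by simp [Finset.sum_add_distrib, hw, hw'],
          by simp [Finset.sum_add_distrib, conjugate_add]⟩
      smul_mem' := by
        rintro c _ ⟨w, hw, rfl⟩
        exact ⟨c • w, by simp [← Finset.smul_sum, hw],
          by simp [Finset.smul_sum, conjugate_smul]⟩ }
  have hW : ∀ (u : X →ₗ[k] Y) (h : G), u.conjugate h - u ∈ W := by
    intro u h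
    refine ⟨Pi.single h u - Pi.single 1 u, by simp [Finset.sum_sub_distrib], ?_⟩
    have e : ∀ (a : G) (i : G), (Pi.single a u - Pi.single 1 u : G → (X →ₗ[k] Y)) i =
      (Pi.single a u : G → (X →ₗ[k] Y)) i + (-1 : k) • (Pi.single 1 u : G → (X →ₗ[k] Y)) i := by
      intro a i
      simp [sub_eq_add_neg]
    have e' : ∀ a : G, ∑ i, ((Pi.single a u : G → (X →ₗ[k] Y)) i).conjugate i
        = u.conjugate a := by
      intro a
      rw [Finset.sum_eq_single a]
      · simp
      · intro b _ hb
        rw [Pi.single_eq_of_ne hb]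
        ext
        simp [LinearMap.conjugate_apply]
      · simp
    simp only [e, conjugate_add, conjugate_smul, Finset.sum_add_distrib, ← Finset.smul_sum, e',
      conjugate_one]
    simp [sub_eq_add_neg]
  -- A functional that kills `W` but not `v` is the trace form of some `g`. Vanishing on all
  -- `u.conjugate h - u` makes `g` equivariant, against `hv`.
  by_contra hvW
  obtain ⟨μ, hμ, hμW⟩ := Submodule.exists_le_ker_of_notMem (p := W) hvW
  obtain ⟨g, hg⟩ := exists_trace_comp_eq μ
  have hgc : ∀ h : G, g.conjugate h = g := by
    intro h
    refine sub_eq_zero.1 (eq_zero_of_trace_comp_eq_zero _ fun u => ?_)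
    have := hμW (hW u h⁻¹)
    rw [LinearMap.mem_ker, ← hg, LinearMap.comp_sub, map_sub, trace_comp_conjugate, inv_inv]
      at this
    rw [LinearMap.sub_comp, map_sub, this]
  refine hμ ?_
  rw [← hg]
  exact hv (equivariantOfConjugate g hgc)

end Conjugation

/-! ### Endomorphisms of indecomposable modules -/

section Fitting

variable {R : Type u} [Ring R] {M : Type u} [AddCommGroup M] [Module R M]
  [IsNoetherian R M] [IsArtinian R M]

/-- Fitting's lemma for indecomposable modules. -/
theorem IsIndecomposable.isNilpotent_or_isUnit (hM : IsIndecomposable R M)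
    (f : Module.End R M) : IsNilpotent f ∨ IsUnit f := by
  -- The exponent must be positive for invertibility of `f ^ n` to imply that of `f`.
  obtain ⟨n, hn, h0⟩ := (f.eventually_isCompl_ker_pow_range_pow.and
    (Filter.eventually_gt_atTop 0)).exists
  rcases hM.2 _ _ hn with h | h
  · right
    have hinj : Function.Injective (f ^ n) := LinearMap.ker_eq_bot.1 h
    have hu : IsUnit (f ^ n) := by
      rw [Module.End.isUnit_iff]
      exact IsArtinian.bijective_of_injective_endomorphism _ hinj
    exact (isUnit_pow_iff h0.ne').1 hu
  · exact Or.inl ⟨n, LinearMap.range_eq_bot.1 h⟩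

/-- The endomorphism ring is local: once the sum is scaled to `1`, one summand is nilpotent, so the
other is `1` minus a nilpotent. -/
theorem IsIndecomposable.not_isUnit_add (hM : IsIndecomposable R M) {f g : Module.End R M}
    (hf : ¬ IsUnit f) (hg : ¬ IsUnit g) : ¬ IsUnit (f + g) := by
  rintro ⟨u, hu⟩
  have h1 : (↑u⁻¹ * f : Module.End R M) + ↑u⁻¹ * g = 1 := by
    rw [← mul_add, ← hu, Units.inv_mul]
  have hn : IsNilpotent (↑u⁻¹ * f : Module.End R M) := by
    refine (hM.isNilpotent_or_isUnit _).resolve_right fun h => hf ?_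
    simpa using u.isUnit.mul h
  have h2 : IsUnit (↑u⁻¹ * g : Module.End R M) := by
    rw [eq_sub_of_add_eq' h1]
    exact hn.isUnit_one_sub
  exact hg (by simpa using u.isUnit.mul h2)

end Fitting

/-! ### Maps that factor through projective modules -/

section FactorsThroughProjective

variable {R : Type u} [Ring R] {X Y Z : FGModuleCat.{u} R}

/-- A map factors through a finitely generated projective module. -/
def FactorsThroughProjective (f : X →ₗ[R] Y) : Prop :=
  ∃ P : FGModuleCat.{u} R, Module.Projective R P ∧
    ∃ (a : X →ₗ[R] P) (b : P →ₗ[R] Y), b ∘ₗ a = f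

theorem toStMod_map_eq_iff (f g : X →ₗ[R] Y) :
    (toStMod R).map (mkHom f) = (toStMod R).map (mkHom g) ↔
      FactorsThroughProjective (f - g) := by
  rw [Quotient.functor_map_eq_iff]
  constructor
  · rintro ⟨P, hP, a, b, h⟩
    refine ⟨P, hP, a.hom.hom, b.hom.hom, ?_⟩
    ext x
    exact (LinearMap.congr_fun (congrArg (fun t => t.hom.hom) h) x).symm
  · rintro ⟨P, hP, a, b, h⟩
    refine ⟨P, hP, mkHom a, mkHom b, ?_⟩
    ext x
    exact (LinearMap.congr_fun h x).symm

theorem toStMod_map_eq_zero_iff (f : X →ₗ[R] Y) :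
    (toStMod R).map (mkHom f) = 0 ↔ FactorsThroughProjective f := by
  rw [← sub_zero f, ← toStMod_map_eq_iff, sub_zero]
  rfl

theorem exists_toStMod_map_eq (f : (toStMod R).obj X ⟶ (toStMod R).obj Y) :
    ∃ g : X →ₗ[R] Y, (toStMod R).map (mkHom g) = f := by
  obtain ⟨g, hg⟩ := (toStMod R).map_surjective f
  exact ⟨g.hom.hom, hg⟩

namespace FactorsThroughProjective

theorem comp {f : X →ₗ[R] Y} (hf : FactorsThroughProjective f) (g : Y →ₗ[R] Z) :
    FactorsThroughProjective (g ∘ₗ f) := by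
  obtain ⟨P, hP, a, b, rfl⟩ := hf
  exact ⟨P, hP, a, g ∘ₗ b, rfl⟩

theorem precomp {g : Y →ₗ[R] Z} (hg : FactorsThroughProjective g) (f : X →ₗ[R] Y) :
    FactorsThroughProjective (g ∘ₗ f) := by
  obtain ⟨P, hP, a, b, rfl⟩ := hg
  exact ⟨P, hP, a ∘ₗ f, b, rfl⟩

theorem add {f g : X →ₗ[R] Y} (hf : FactorsThroughProjective f)
    (hg : FactorsThroughProjective g) : FactorsThroughProjective (f + g) := by
  rw [← toStMod_map_eq_zero_iff] at *
  have : (toStMod R).map (mkHom (f + g)) = (toStMod R).map (mkHom f)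
    + (toStMod R).map (mkHom g) := rfl
  rw [this, hf, hg, add_zero]

theorem neg {f : X →ₗ[R] Y} (hf : FactorsThroughProjective f) :
    FactorsThroughProjective (-f) := by
  obtain ⟨P, hP, a, b, rfl⟩ := hf
  exact ⟨P, hP, a, -b, LinearMap.neg_comp ..⟩

theorem projective (h : FactorsThroughProjective (LinearMap.id : X →ₗ[R] X)) :
    Module.Projective R X := by
  obtain ⟨P, hP, a, b, h⟩ := h
  exact Module.Projective.of_split a b h

/-- A map that factors through a projective module lifts along any surjection. -/
theorem exists_lift {f : X →ₗ[R] Y} (hf : FactorsThroughProjective f) {W : Type*}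
    [AddCommGroup W] [Module R W] (p : W →ₗ[R] Y)
    (hp : Function.Surjective p) : ∃ h : X →ₗ[R] W, p ∘ₗ h = f := by
  obtain ⟨P, hP, a, b, rfl⟩ := hf
  obtain ⟨c, hc⟩ := Module.projective_lifting_property p b hp
  exact ⟨c ∘ₗ a, by rw [← LinearMap.comp_assoc, hc]⟩

end FactorsThroughProjective

/-- All idempotents of the stable endomorphism ring are trivial. -/
def StablyConnected (X : FGModuleCat.{u} R) : Prop :=
  ∀ e : X →ₗ[R] X, FactorsThroughProjective (e ∘ₗ e - e) →
    FactorsThroughProjective e ∨ FactorsThroughProjective (e - LinearMap.id)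

/-- An indecomposable module of finite length is stably connected. -/
theorem IsIndecomposable.stablyConnected [IsNoetherian R X] [IsArtinian R X]
    (hX : IsIndecomposable R X) : StablyConnected X := by
  intro e he
  -- All positive powers of `e` are stably equal to `e`. By Fitting, `e` is nilpotent, hence stably
  -- zero, or invertible, hence stably the identity.
  have hpow : ∀ n : ℕ, FactorsThroughProjective
      ((e ^ (n + 1) : Module.End R X) - e) := by
    intro n
    induction n with
    | zero =>
      rw [zero_add, pow_one, sub_self, ← toStMod_map_eq_zero_iff]
      rfl
    | succ n ih =>
      have h : (e ^ (n + 1 + 1) : Module.End R X) - e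
          = ((e ^ (n + 1) : Module.End R X) - e) ∘ₗ e + (e ∘ₗ e - e) := by
        rw [pow_succ, LinearMap.sub_comp, sub_add_sub_cancel]
        rfl
      rw [h]
      exact (ih.precomp e).add he
  rcases hX.isNilpotent_or_isUnit e with ⟨n, hn⟩ | ⟨v, hv⟩
  · left
    have h := (hpow n).neg
    rw [pow_succ, hn, zero_mul, zero_sub, neg_neg] at h
    exact h
  · right
    have h := he.precomp (↑v⁻¹ : Module.End R X)
    have h1 : e ∘ₗ (↑v⁻¹ : Module.End R X) = LinearMap.id := by
      rw [← hv]
      exact v.mul_inv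
    rw [LinearMap.sub_comp, LinearMap.comp_assoc, h1] at h
    exact h

/-- A stable split epimorphism from a stably connected module to a non-projective module is
a stable isomorphism. -/
theorem StablyConnected.nonempty_iso (hX : StablyConnected X) (hY : ¬ Module.Projective R Y)
    (f : X →ₗ[R] Y) (s : Y →ₗ[R] X) (h : f ∘ₗ s = LinearMap.id) :
    Nonempty ((toStMod R).obj Y ≅ (toStMod R).obj X) := by
  have he : FactorsThroughProjective ((s ∘ₗ f) ∘ₗ (s ∘ₗ f) - s ∘ₗ f) := by
    have : (s ∘ₗ f) ∘ₗ (s ∘ₗ f) = s ∘ₗ f := by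
      rw [LinearMap.comp_assoc, ← LinearMap.comp_assoc f s f, h, LinearMap.id_comp]
    rw [← toStMod_map_eq_iff, this]
  rcases hX _ he with h' | h'
  -- Here `s ∘ f` is stably zero, hence so is `f ∘ (s ∘ f) ∘ s = id`.
  · refine absurd (FactorsThroughProjective.projective ?_) hY
    have := (h'.comp f).precomp s
    rwa [LinearMap.comp_assoc, LinearMap.comp_assoc, h, LinearMap.comp_id, h] at this
  · refine ⟨⟨(toStMod R).map (mkHom s), (toStMod R).map (mkHom f), ?_, ?_⟩⟩
    · rw [← Functor.map_comp, ← CategoryTheory.Functor.map_id]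
      exact congrArg (fun t => (toStMod R).map (mkHom t)) h
    · rw [← Functor.map_comp, ← CategoryTheory.Functor.map_id]
      exact (toStMod_map_eq_iff _ _).2 h'

end FactorsThroughProjective

/-! ### Self-injectivity of the group algebra -/

section Group

variable {k G : Type u} [Field k]

section Coefficients

variable {X : Type u} [AddCommGroup X] [Module k X]

/-- The coefficient of `g` of an element of `kG ⊗ X`. -/
def tensorCoeff (g : G) : MonoidAlgebra k G ⊗[k] X →ₗ[k] X :=
  (TensorProduct.lid k X).toLinearMap ∘ₗ
    (Finsupp.lapply g ∘ₗ (MonoidAlgebra.coeffLinearEquiv (S := k) k).toLinearMap).rTensor X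

theorem tensorCoeff_single_tmul [DecidableEq G] (g h : G) (x : X) :
    tensorCoeff (k := k) g (MonoidAlgebra.single h (1 : k) ⊗ₜ x) = if h = g then x else 0 := by
  simp [tensorCoeff, Finsupp.single_apply]

variable [Group G] [Fintype G]

theorem sum_single_tmul_tensorCoeff (t : MonoidAlgebra k G ⊗[k] X) :
    ∑ g : G, MonoidAlgebra.single g (1 : k) ⊗ₜ[k] tensorCoeff g t = t := by
  classical
  induction t with
  | zero => simp
  | add a b ha hb => simp only [map_add, tmul_add, Finset.sum_add_distrib, ha, hb]
  | tmul a x =>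
    induction a using MonoidAlgebra.induction_linear with
    | zero => simp
    | add a b ha hb =>
      simp only [add_tmul, map_add, tmul_add, Finset.sum_add_distrib, ha, hb]
    | single h c =>
      have : (MonoidAlgebra.single h c : MonoidAlgebra k G) = c • MonoidAlgebra.single h 1 := by
        simp
      simp only [this, ← smul_tmul', map_smul, tmul_smul, ← Finset.smul_sum,
        tensorCoeff_single_tmul]
      simp [tmul_ite]

theorem tensorCoeff_smul (g h : G) (t : MonoidAlgebra k G ⊗[k] X) :
    tensorCoeff g (MonoidAlgebra.single h (1 : k) • t) = tensorCoeff (h⁻¹ * g) t := by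
  classical
  conv_lhs => rw [← sum_single_tmul_tensorCoeff t]
  simp only [Finset.smul_sum, smul_tmul', smul_eq_mul, MonoidAlgebra.single_mul_single, mul_one,
    map_sum, tensorCoeff_single_tmul]
  simp [← eq_inv_mul_iff_mul_eq]

theorem tensorCoeff_coextend {B : Type u} [AddCommGroup B] [Module k B]
    [Module (MonoidAlgebra k G) B] [IsScalarTower k (MonoidAlgebra k G) B]
    (r : B →ₗ[k] X) (g : G) (b : B) :
    tensorCoeff g (coextend r b) = r (MonoidAlgebra.single g⁻¹ (1 : k) • b) := by
  classical
  simp [coextend_apply, tensorCoeff_single_tmul]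

/-- Since `G` is finite, `kG ⊗ X` is also coinduced: an equivariant map into it is determined by its
coefficient at `1`. -/
theorem eq_coextend {B : Type u} [AddCommGroup B] [Module k B]
    [Module (MonoidAlgebra k G) B] [IsScalarTower k (MonoidAlgebra k G) B]
    (f : B →ₗ[MonoidAlgebra k G] MonoidAlgebra k G ⊗[k] X) :
    f = coextend (tensorCoeff 1 ∘ₗ f.restrictScalars k) := by
  ext b
  rw [coextend_apply, ← sum_single_tmul_tensorCoeff (f b)]
  refine Finset.sum_congr rfl fun g _ => ?_
  simp [map_smul, tensorCoeff_smul]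

end Coefficients

attribute [local instance] ModuleCat.moduleOfAlgebraModule
  ModuleCat.isScalarTower_of_algebra_moduleCat

variable [Group G]

theorem counit_surjective (M : FGModuleCat.{u} (MonoidAlgebra k G)) :
    Function.Surjective (counit (k := k) (G := G) M) := fun m => ⟨1 ⊗ₜ m, by simp⟩

variable [Fintype G]

instance finite_of_fgModuleCat (M : FGModuleCat.{u} (MonoidAlgebra k G)) : Module.Finite k M :=
  Module.Finite.trans (MonoidAlgebra k G) M

instance isArtinian_of_fgModuleCat (M : FGModuleCat.{u} (MonoidAlgebra k G)) :
    IsArtinian (MonoidAlgebra k G) M :=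
  isArtinian_of_tower k inferInstance

theorem unit_injective (M : FGModuleCat.{u} (MonoidAlgebra k G)) :
    Function.Injective (unit (k := k) (G := G) M) := by
  intro x y h
  have := congrArg (tensorCoeff 1) h
  simpa [unit, tensorCoeff_coextend, ← MonoidAlgebra.one_def] using this

/-- Finitely generated projective `kG`-modules are injective. -/
theorem exists_extension {A B P : FGModuleCat.{u} (MonoidAlgebra k G)}
    (hP : Module.Projective (MonoidAlgebra k G) P) (i : A →ₗ[MonoidAlgebra k G] B)
    (hi : Function.Injective i) (a : A →ₗ[MonoidAlgebra k G] P) :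
    ∃ b : B →ₗ[MonoidAlgebra k G] P, b ∘ₗ i = a := by
  -- `P` is a summand of `kG ⊗ P`. Maps into the latter are coextended from linear maps, which
  -- extend along the linear retraction `r` of `i`.
  obtain ⟨s, hs⟩ := Module.projective_lifting_property (counit (k := k) (G := G) P)
    LinearMap.id (counit_surjective P)
  obtain ⟨r, hr⟩ := (i.restrictScalars k).exists_leftInverse_of_injective
    (LinearMap.ker_eq_bot.2 hi)
  let c := tensorCoeff 1 ∘ₗ (s ∘ₗ a).restrictScalars k
  have hc : coextend (c ∘ₗ r) ∘ₗ i = s ∘ₗ a := by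
    rw [eq_coextend (s ∘ₗ a)]
    ext x
    simp only [LinearMap.comp_apply, coextend_apply]
    refine Finset.sum_congr rfl fun g _ => ?_
    rw [← map_smul i]
    exact congrArg (fun t => MonoidAlgebra.single g (1 : k) ⊗ₜ[k] c t) (LinearMap.congr_fun hr _)
  exact ⟨counit P ∘ₗ coextend (c ∘ₗ r), by
    rw [LinearMap.comp_assoc, hc, ← LinearMap.comp_assoc, hs, LinearMap.id_comp]⟩

end Group

/-! ### Short exact sequences with projective middle term -/

namespace SES

section General

variable {R : Type u} [Ring R] {C : FGModuleCat.{u} R}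

theorem proj_inc (E : SES C) (a : E.A) : E.proj (E.inc a) = 0 :=
  (E.exact _).2 ⟨a, rfl⟩

theorem proj_comp_inc (E : SES C) : E.proj ∘ₗ E.inc = 0 :=
  LinearMap.ext E.proj_inc

/-- A map that is killed by `E.proj` lifts to the left term. -/
theorem exists_left {W : Type*} [AddCommGroup W] [Module R W] (E : SES C) (f : W →ₗ[R] E.B)
    (hf : E.proj ∘ₗ f = 0) : ∃ g : W →ₗ[R] E.A, E.inc ∘ₗ g = f := by
  have h : ∀ w, f w ∈ LinearMap.range E.inc := fun w =>
    (E.exact _).1 (LinearMap.congr_fun hf w)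
  refine ⟨(LinearEquiv.ofInjective E.inc E.injective).symm.toLinearMap ∘ₗ
    f.codRestrict (LinearMap.range E.inc) h, ?_⟩
  ext w
  have := (LinearEquiv.ofInjective E.inc E.injective).apply_symm_apply
    (f.codRestrict (LinearMap.range E.inc) h w)
  exact congrArg Subtype.val this

/-- A map that kills the left term descends to the right term. -/
theorem exists_right {W : Type*} [AddCommGroup W] [Module R W] (E : SES C) (f : E.B →ₗ[R] W)
    (hf : f ∘ₗ E.inc = 0) : ∃ g : C →ₗ[R] W, g ∘ₗ E.proj = f := by
  have hk : LinearMap.ker E.proj ≤ LinearMap.ker f := by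
    intro x hx
    obtain ⟨a, rfl⟩ := (E.exact x).1 hx
    exact LinearMap.congr_fun hf a
  refine ⟨(LinearMap.ker E.proj).liftQ f hk ∘ₗ
    (E.proj.quotKerEquivOfSurjective E.surjective).symm.toLinearMap, ?_⟩
  ext x
  have : (E.proj.quotKerEquivOfSurjective E.surjective).symm (E.proj x)
      = (LinearMap.ker E.proj).mkQ x := by
    rw [LinearEquiv.symm_apply_eq]; rfl
  simp only [LinearMap.comp_apply, LinearEquiv.coe_coe, this]
  rfl

variable {C' C'' : FGModuleCat.{u} R}

/-- Two maps of the outer terms are compatible if they extend to a map of sequences. -/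
def Compatible (E : SES C) (E' : SES C') (f : E.A →ₗ[R] E'.A) (g : C →ₗ[R] C') : Prop :=
  ∃ h : E.B →ₗ[R] E'.B, h ∘ₗ E.inc = E'.inc ∘ₗ f ∧ E'.proj ∘ₗ h = g ∘ₗ E.proj

variable {E : SES C} {E' : SES C'} {E'' : SES C''}

theorem Compatible.id (E : SES C) : Compatible E E LinearMap.id LinearMap.id :=
  ⟨LinearMap.id, rfl, rfl⟩

theorem Compatible.sub {f f' : E.A →ₗ[R] E'.A} {g g' : C →ₗ[R] C'}
    (h : Compatible E E' f g) (h' : Compatible E E' f' g') :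
    Compatible E E' (f - f') (g - g') := by
  obtain ⟨b, h1, h2⟩ := h
  obtain ⟨b', h1', h2'⟩ := h'
  exact ⟨b - b', by rw [LinearMap.sub_comp, h1, h1', LinearMap.comp_sub],
    by rw [LinearMap.comp_sub, h2, h2', LinearMap.sub_comp]⟩

theorem Compatible.comp {f : E.A →ₗ[R] E'.A} {g : C →ₗ[R] C'} {f' : E'.A →ₗ[R] E''.A}
    {g' : C' →ₗ[R] C''} (h : Compatible E E' f g) (h' : Compatible E' E'' f' g') :
    Compatible E E'' (f' ∘ₗ f) (g' ∘ₗ g) := by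
  obtain ⟨b, h1, h2⟩ := h
  obtain ⟨b', h1', h2'⟩ := h'
  refine ⟨b' ∘ₗ b, ?_, ?_⟩
  · rw [LinearMap.comp_assoc, h1, ← LinearMap.comp_assoc, h1', LinearMap.comp_assoc]
  · rw [← LinearMap.comp_assoc, h2', LinearMap.comp_assoc, h2, LinearMap.comp_assoc]

theorem exists_compatible_left (hE : Module.Projective R E.B) (g : C →ₗ[R] C') :
    ∃ f, Compatible E E' f g := by
  obtain ⟨b, hb⟩ := Module.projective_lifting_property E'.proj (g ∘ₗ E.proj) E'.surjective
  obtain ⟨f, hf⟩ := E'.exists_left (b ∘ₗ E.inc) (by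
    rw [← LinearMap.comp_assoc, hb, LinearMap.comp_assoc, E.proj_comp_inc, LinearMap.comp_zero])
  exact ⟨f, b, hf.symm, hb⟩

/-- If the map on right terms lifts to the middle term, then the map on left terms extends to the
middle term. -/
theorem Compatible.exists_extension_left {f : E.A →ₗ[R] E'.A} {g : C →ₗ[R] C'}
    (h : Compatible E E' f g) (hg : ∃ t : C →ₗ[R] E'.B, E'.proj ∘ₗ t = g) :
    ∃ s : E.B →ₗ[R] E'.A, s ∘ₗ E.inc = f := by
  obtain ⟨b, h1, h2⟩ := h
  obtain ⟨t, ht⟩ := hg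
  -- Subtracting `t ∘ E.proj` pushes `b` into `E'.A` without changing it on `E.A`.
  obtain ⟨s, hs⟩ := E'.exists_left (b - t ∘ₗ E.proj) (by
    rw [LinearMap.comp_sub, h2, ← LinearMap.comp_assoc, ht, sub_self])
  refine ⟨s, LinearMap.ext fun x => E'.injective ?_⟩
  have e1 := LinearMap.congr_fun hs (E.inc x)
  have e2 := LinearMap.congr_fun h1 x
  simp only [LinearMap.comp_apply, LinearMap.sub_apply, E.proj_inc, map_zero, sub_zero]
    at e1 e2 ⊢
  rw [e1, e2]

/-- A stably zero `g` lifts to `E'.B`, so `f` extends over the projective `E.B`. This makes the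
syzygy well defined on stable maps. -/
theorem Compatible.left (hE : Module.Projective R E.B) {f : E.A →ₗ[R] E'.A} {g : C →ₗ[R] C'}
    (h : Compatible E E' f g) (hg : FactorsThroughProjective g) : FactorsThroughProjective f := by
  obtain ⟨s, hs⟩ := h.exists_extension_left (hg.exists_lift E'.proj E'.surjective)
  exact ⟨E.B, hE, E.inc, s, hs⟩

/-- A retraction of the inclusion gives a section of the projection. -/
theorem exists_section (E : SES C) (r : E.B →ₗ[R] E.A) (hr : r ∘ₗ E.inc = LinearMap.id) :
    ∃ s : C →ₗ[R] E.B, E.proj ∘ₗ s = LinearMap.id := by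
  obtain ⟨s, hs⟩ := E.exists_right (LinearMap.id - E.inc ∘ₗ r) (by
    rw [LinearMap.sub_comp, LinearMap.comp_assoc, hr]; simp)
  refine ⟨s, ?_⟩
  ext x
  obtain ⟨y, rfl⟩ := E.surjective x
  have e := LinearMap.congr_fun hs y
  simp only [LinearMap.comp_apply, LinearMap.sub_apply, LinearMap.id_apply] at e ⊢
  rw [e, map_sub, E.proj_inc, sub_zero]

end General

section Group

variable {k G : Type u} [Field k] [Group G] [Fintype G]
  {C C' : FGModuleCat.{u} (MonoidAlgebra k G)} {E : SES C} {E' : SES C'}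

theorem exists_compatible_right (hE' : Module.Projective (MonoidAlgebra k G) E'.B)
    (f : E.A →ₗ[MonoidAlgebra k G] E'.A) : ∃ g, Compatible E E' f g := by
  obtain ⟨b, hb⟩ := exists_extension hE' E.inc E.injective (E'.inc ∘ₗ f)
  obtain ⟨g, hg⟩ := E.exists_right (E'.proj ∘ₗ b) (by
    rw [LinearMap.comp_assoc, hb, ← LinearMap.comp_assoc, E'.proj_comp_inc, LinearMap.zero_comp])
  exact ⟨g, b, hb, hg.symm⟩

/-- Dual argument: the projective through which `f` factors is injective, so `f` can be subtracted
from the middle map, which then descends to a lift of `g` to `E'.B`. -/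
theorem Compatible.right (hE' : Module.Projective (MonoidAlgebra k G) E'.B)
    {f : E.A →ₗ[MonoidAlgebra k G] E'.A}
    {g : C →ₗ[MonoidAlgebra k G] C'} (h : Compatible E E' f g)
    (hf : FactorsThroughProjective f) : FactorsThroughProjective g := by
  obtain ⟨b, h1, h2⟩ := h
  obtain ⟨Q, hQ, a, c, rfl⟩ := hf
  obtain ⟨a', ha'⟩ := exists_extension hQ E.inc E.injective a
  obtain ⟨t, ht⟩ := E.exists_right (b - E'.inc ∘ₗ c ∘ₗ a') (by
    rw [LinearMap.sub_comp, h1, LinearMap.comp_assoc, LinearMap.comp_assoc, ha', sub_self])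
  refine ⟨E'.B, hE', t, E'.proj, ?_⟩
  ext x
  obtain ⟨y, rfl⟩ := E.surjective x
  have e1 := LinearMap.congr_fun ht y
  have e2 := LinearMap.congr_fun h2 y
  simp only [LinearMap.comp_apply, LinearMap.sub_apply] at e1 e2 ⊢
  rw [e1, map_sub, e2, E'.proj_inc, sub_zero]

/-- Compatible pairs carry stable vanishing both ways, so stable idempotents of the two end terms
correspond. -/
theorem stablyConnected_right (hE : Module.Projective (MonoidAlgebra k G) E.B)
    (h : StablyConnected E.A) : StablyConnected C := by
  intro e he
  obtain ⟨f, hf⟩ := exists_compatible_left (E' := E) hE e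
  rcases h f (((hf.comp hf).sub hf).left hE he) with h' | h'
  · exact Or.inl (hf.right hE h')
  · exact Or.inr ((hf.sub (Compatible.id E)).right hE h')

theorem stablyConnected_left (hE : Module.Projective (MonoidAlgebra k G) E.B)
    (h : StablyConnected C) : StablyConnected E.A := by
  intro e he
  obtain ⟨g, hg⟩ := exists_compatible_right (E' := E) hE e
  rcases h g (((hg.comp hg).sub hg).right hE he) with h' | h'
  · exact Or.inl (hg.left hE h')
  · exact Or.inr ((hg.sub (Compatible.id E)).left hE h')

attribute [local instance] ModuleCat.moduleOfAlgebraModule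
  ModuleCat.isScalarTower_of_algebra_moduleCat

/-- The sequence `0 ⟶ Ω M ⟶ kG ⊗ M ⟶ M ⟶ 0`. -/
def omega (M : FGModuleCat.{u} (MonoidAlgebra k G)) : SES M where
  A := Omega M
  B := FGModuleCat.of _ (MonoidAlgebra k G ⊗[k] M)
  inc := (LinearMap.ker (counit (k := k) (G := G) M)).subtype
  proj := counit M
  injective := Submodule.subtype_injective _
  exact := LinearMap.exact_subtype_ker_map _
  surjective := counit_surjective M

/-- The sequence `0 ⟶ M ⟶ kG ⊗ M ⟶ Ω⁻¹ M ⟶ 0`. -/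
def omegaInv (M : FGModuleCat.{u} (MonoidAlgebra k G)) : SES (OmegaInv M) where
  A := M
  B := FGModuleCat.of _ (MonoidAlgebra k G ⊗[k] M)
  inc := unit M
  proj := (LinearMap.range (unit (k := k) (G := G) M)).mkQ
  injective := unit_injective M
  exact := LinearMap.exact_map_mkQ_range _
  surjective := Submodule.mkQ_surjective _

theorem projective_omega (M : FGModuleCat.{u} (MonoidAlgebra k G)) :
    Module.Projective (MonoidAlgebra k G) (omega M).B :=
  inferInstanceAs (Module.Projective (MonoidAlgebra k G) (MonoidAlgebra k G ⊗[k] M))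

theorem projective_omegaInv (M : FGModuleCat.{u} (MonoidAlgebra k G)) :
    Module.Projective (MonoidAlgebra k G) (omegaInv M).B :=
  inferInstanceAs (Module.Projective (MonoidAlgebra k G) (MonoidAlgebra k G ⊗[k] M))

/-- If the middle term is projective, then `C` is stably isomorphic to `Ω⁻¹ A`. -/
theorem nonempty_iso_omegaInv (E : SES C) (hE : Module.Projective (MonoidAlgebra k G) E.B) :
    Nonempty ((toStMod _).obj (OmegaInv E.A) ≅ (toStMod _).obj C) := by
  obtain ⟨g, hg⟩ := exists_compatible_right (E := omegaInv E.A) (E' := E) hE LinearMap.id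
  obtain ⟨g', hg'⟩ := exists_compatible_right (E := E) (E' := omegaInv E.A)
    (projective_omegaInv E.A) LinearMap.id
  have h1 := (hg.comp hg').sub (Compatible.id _)
  have h2 := (hg'.comp hg).sub (Compatible.id _)
  have z : ∀ X : FGModuleCat.{u} (MonoidAlgebra k G), FactorsThroughProjective
      (LinearMap.id ∘ₗ LinearMap.id - LinearMap.id : X →ₗ[MonoidAlgebra k G] X) := fun X => by
    rw [← toStMod_map_eq_iff]
  refine ⟨⟨(toStMod _).map (mkHom g), (toStMod _).map (mkHom g'), ?_, ?_⟩⟩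
  · rw [← Functor.map_comp, ← CategoryTheory.Functor.map_id]
    exact (toStMod_map_eq_iff _ _).2 (h1.right (projective_omegaInv E.A) (z _))
  · rw [← Functor.map_comp, ← CategoryTheory.Functor.map_id]
    exact (toStMod_map_eq_iff _ _).2 (h2.right hE (z _))

end Group

end SES

/-! ### Maps annihilated by the connecting map of an almost split sequence -/

section Group

variable {k G : Type u} [Field k] [Group G] [Fintype G]

/-- The syzygies built from `kG ⊗ M` are not minimal and may have projective summands; stable
connectedness survives where indecomposability need not. -/
theorem stablyConnected_omegaPow {M : FGModuleCat.{u} (MonoidAlgebra k G)}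
    (hM : StablyConnected M) (i : ℤ) : StablyConnected (OmegaPow i M) := by
  have h1 : ∀ X : FGModuleCat.{u} (MonoidAlgebra k G), StablyConnected X →
      StablyConnected (Omega X) := fun X h =>
    SES.stablyConnected_left (SES.projective_omega X) h
  have h2 : ∀ X : FGModuleCat.{u} (MonoidAlgebra k G), StablyConnected X →
      StablyConnected (OmegaInv X) := fun X h =>
    SES.stablyConnected_right (SES.projective_omegaInv X) h
  have iter : ∀ F : FGModuleCat.{u} (MonoidAlgebra k G) → FGModuleCat.{u} (MonoidAlgebra k G),
      (∀ X, StablyConnected X → StablyConnected (F X)) → ∀ n : ℕ, StablyConnected (F^[n] M) := by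
    intro F hF n
    induction n with
    | zero => exact hM
    | succ n ih =>
      rw [Function.iterate_succ_apply']
      exact hF _ ih
  cases i with
  | ofNat n => exact iter _ h1 n
  | negSucc n => exact iter _ h2 (n + 1)

attribute [local instance] ModuleCat.moduleOfAlgebraModule
  ModuleCat.isScalarTower_of_algebra_moduleCat

variable {N : FGModuleCat.{u} (MonoidAlgebra k G)}

/-- The composition of the projection with the connecting map is stably zero. -/
theorem SES.proj_comp_connecting (E : SES N) :
    (toStMod _).map (mkHom E.proj) ≫ E.connecting = 0 := by
  obtain ⟨b, -, h⟩ := E.exists_connecting.choose_spec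
  unfold SES.connecting
  rw [← Functor.map_comp]
  refine (toStMod_map_eq_zero_iff _).2 ⟨_, projective_omegaInv E.A, b, (omegaInv E.A).proj, ?_⟩
  exact h.symm

/-- The connecting map of a non-split sequence is not zero. -/
theorem SES.connecting_ne_zero (E : SES N)
    (hE : ¬ ∃ s : N →ₗ[MonoidAlgebra k G] E.B, E.proj ∘ₗ s = LinearMap.id) :
    E.connecting ≠ 0 := by
  obtain ⟨b, hb, h⟩ := E.exists_connecting.choose_spec
  unfold SES.connecting
  intro h0
  have hc : Compatible E (omegaInv E.A) LinearMap.id E.exists_connecting.choose :=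
    ⟨b, hb, h.symm⟩
  -- A stably zero connecting map lifts to `kG ⊗ A`, so the identity of `A` extends to `B`: a
  -- retraction of the inclusion.
  obtain ⟨r, hr⟩ := hc.exists_extension_left (((toStMod_map_eq_zero_iff _).1 h0).exists_lift
    (omegaInv E.A).proj (omegaInv E.A).surjective)
  exact hE (E.exists_section r hr)

theorem IsAlmostSplitConnecting.ne_zero {φ : (toStMod _).obj N ⟶ (toStMod _).obj (Omega N)}
    (h : IsAlmostSplitConnecting N φ) : φ ≠ 0 := by
  obtain ⟨E, hE, ψ, rfl⟩ := h
  intro h0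
  refine E.connecting_ne_zero hE.nonsplit ?_
  rw [← cancel_mono ψ.hom, h0, Limits.zero_comp]

/-- The connecting map of an almost split sequence annihilates the stable maps from a stably
connected module that is not stably isomorphic to `N`. -/
theorem IsAlmostSplitConnecting.comp_eq_zero
    {φ : (toStMod _).obj N ⟶ (toStMod _).obj (Omega N)} (h : IsAlmostSplitConnecting N φ)
    (hN : ¬ Module.Projective (MonoidAlgebra k G) N) {X : FGModuleCat.{u} (MonoidAlgebra k G)}
    (hX : StablyConnected X) (hNX : IsEmpty ((toStMod _).obj N ≅ (toStMod _).obj X))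
    (f : (toStMod _).obj X ⟶ (toStMod _).obj N) : f ≫ φ = 0 := by
  obtain ⟨E, hE, ψ, rfl⟩ := h
  obtain ⟨f, rfl⟩ := exists_toStMod_map_eq f
  obtain ⟨g, rfl⟩ := hE.lift X f fun ⟨s, hs⟩ =>
    not_nonempty_iff.2 hNX (hX.nonempty_iso hN f s hs)
  have h : (toStMod _).map (mkHom (E.proj ∘ₗ g)) =
      (toStMod _).map (mkHom g) ≫ (toStMod _).map (mkHom E.proj) := rfl
  rw [h, Category.assoc, reassoc_of% E.proj_comp_connecting, Limits.zero_comp, Limits.comp_zero]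

end Group

variable {k G : Type u} [Field k] [Group G] [Fintype G]

/-! ### Minimal syzygies -/

section MinimalSyzygy

attribute [local instance] ModuleCat.moduleOfAlgebraModule
  ModuleCat.isScalarTower_of_algebra_moduleCat

variable {C : FGModuleCat.{u} (MonoidAlgebra k G)}

/-- A projective direct summand of the left term can be removed. -/
theorem SES.exists_remove_projective (E : SES C)
    (hE : Module.Projective (MonoidAlgebra k G) E.B) {U V : Submodule (MonoidAlgebra k G) E.A}
    (hUV : IsCompl U V) (hU : Module.Projective (MonoidAlgebra k G) U) :
    ∃ E' : SES C, Module.Projective (MonoidAlgebra k G) E'.B ∧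
      Nonempty (E'.A ≃ₗ[MonoidAlgebra k G] V) := by
  -- `U` is also injective, so the projection of `E.A` onto `U` extends to `E.B`. The kernel of the
  -- extension `r` is a complement of the image of `U` and serves as the new middle term.
  obtain ⟨r, hr⟩ := exists_extension (P := FGModuleCat.of _ U) hU E.inc E.injective
    (U.projectionOnto V hUV)
  replace hr : ∀ a, r (E.inc a) = U.projectionOnto V hUV a := LinearMap.congr_fun hr
  change E.B →ₗ[MonoidAlgebra k G] U at r
  let c : E.B →ₗ[MonoidAlgebra k G] LinearMap.ker r :=
    (LinearMap.id - E.inc ∘ₗ U.subtype ∘ₗ r).codRestrict _ fun b => by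
      have h := (hr (r b).1).trans (Submodule.projectionOnto_apply_left hUV (r b))
      simp only [LinearMap.mem_ker, LinearMap.sub_apply, LinearMap.comp_apply,
        LinearMap.id_apply, Submodule.subtype_apply, map_sub]
      rw [h, sub_self]
  have hc : c ∘ₗ (LinearMap.ker r).subtype = LinearMap.id := by
    ext ⟨b, hb⟩
    have hb : r b = 0 := hb
    simp [c, hb]
  let E' : SES C :=
    { A := FGModuleCat.of _ V
      B := FGModuleCat.of _ (LinearMap.ker r)
      inc := (E.inc ∘ₗ V.subtype).codRestrict _ fun v =>
        (hr v.1).trans (Submodule.projectionOnto_apply_right hUV v)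
      proj := E.proj ∘ₗ (LinearMap.ker r).subtype
      injective := fun x y hxy => Subtype.ext (E.injective (congrArg Subtype.val hxy))
      exact := by
        rintro ⟨b, hb⟩
        constructor
        · intro h
          obtain ⟨a, rfl⟩ := (E.exact b).1 h
          exact ⟨⟨a, (Submodule.projectionOnto_apply_eq_zero_iff hUV).1 ((hr a).symm.trans hb)⟩,
            rfl⟩
        · rintro ⟨v, hv⟩
          obtain rfl := congrArg Subtype.val hv
          exact E.proj_inc _
      surjective := fun x => by
        obtain ⟨b, rfl⟩ := E.surjective x
        refine ⟨c b, ?_⟩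
        change E.proj (b - E.inc (r b).1) = E.proj b
        rw [map_sub, E.proj_inc, sub_zero] }
  exact ⟨E', Module.Projective.of_split _ c hc, ⟨LinearEquiv.refl _ _⟩⟩

/-- The identity of `U` is the projection restricted to `U` on both sides. -/
theorem projective_of_factorsThroughProjective_projection {A : FGModuleCat.{u} (MonoidAlgebra k G)}
    {U V : Submodule (MonoidAlgebra k G) A} (hUV : IsCompl U V)
    (h : FactorsThroughProjective (U.projection V hUV)) :
    Module.Projective (MonoidAlgebra k G) U := by
  refine FactorsThroughProjective.projective
    (X := FGModuleCat.of (MonoidAlgebra k G) U) ?_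
  have h' := (h.comp (Z := FGModuleCat.of _ U) (U.projectionOnto V hUV)).precomp
    (X := FGModuleCat.of _ U) U.subtype
  convert h' using 1
  ext x
  change (x : A) = _
  simp

/-- A non-projective module with trivial stable idempotents has a projective presentation whose
kernel is indecomposable. -/
theorem exists_indecomposable_syzygy (hC : ¬ Module.Projective (MonoidAlgebra k G) C)
    (hC' : StablyConnected C) :
    ∃ E : SES C, Module.Projective (MonoidAlgebra k G) E.B ∧
      IsIndecomposable (MonoidAlgebra k G) E.A := by
  -- A kernel of minimal length has no nonzero projective summand. In any decomposition one of the
  -- two projections is stably zero, so that summand is projective and hence zero.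
  obtain ⟨⟨E, hE⟩, hmin⟩ := exists_minimalFor_of_wellFoundedLT (fun _ => True)
    (fun E : {E : SES C // Module.Projective (MonoidAlgebra k G) E.B} =>
      Module.length (MonoidAlgebra k G) E.1.A) ⟨⟨_, SES.projective_omega C⟩, trivial⟩
  have key : ∀ U V : Submodule (MonoidAlgebra k G) E.A, IsCompl U V →
      Module.Projective (MonoidAlgebra k G) U → U = ⊥ := by
    intro U V hUV hU
    obtain ⟨E', hE', ⟨e⟩⟩ := E.exists_remove_projective hE hUV hU
    have hV : V = ⊤ := by
      by_contra hV
      have h1 := Submodule.length_lt hV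
      rw [← e.length_eq] at h1
      exact h1.not_ge (hmin.2 (j := ⟨E', hE'⟩) trivial h1.le)
    rw [hV] at hUV
    exact eq_bot_of_top_isCompl hUV.symm
  refine ⟨E, hE, ?_, fun U V hUV => ?_⟩
  · by_contra h
    rw [not_nontrivial_iff_subsingleton] at h
    have hinj : Function.Injective E.proj := by
      rw [injective_iff_map_eq_zero]
      intro b hb
      obtain ⟨a, rfl⟩ := (E.exact b).1 hb
      rw [Subsingleton.elim a 0, map_zero]
    exact hC (Module.Projective.of_equiv (LinearEquiv.ofBijective E.proj ⟨hinj, E.surjective⟩))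
  · have hA := SES.stablyConnected_left hE hC'
    have he : FactorsThroughProjective
        (U.projection V hUV ∘ₗ U.projection V hUV - U.projection V hUV) := by
      rw [← toStMod_map_eq_iff]
      exact congrArg (fun t => (toStMod _).map (mkHom t))
        (Submodule.isIdempotentElem_projection hUV)
    rcases hA _ he with h | h
    · exact Or.inl (key U V hUV (projective_of_factorsThroughProjective_projection hUV h))
    · refine Or.inr (key V U hUV.symm
        (projective_of_factorsThroughProjective_projection hUV.symm ?_))
      rw [Submodule.projection_eq_id_sub_projection, ← neg_sub]
      exact h.neg

end MinimalSyzygy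

/-! ### The almost vanishing map -/

section AlmostVanishing

theorem counit_eq_sum {M : Type u} [AddCommGroup M] [Module k M] [Module (MonoidAlgebra k G) M]
    [IsScalarTower k (MonoidAlgebra k G) M] (t : MonoidAlgebra k G ⊗[k] M) :
    counit M t = ∑ g : G, MonoidAlgebra.single g (1 : k) • tensorCoeff g t := by
  conv_lhs => rw [← sum_single_tmul_tensorCoeff t]
  simp

/-- Norms of linear maps factor through a free module, and a coextension lands in the kernel of
`counit` exactly when the norm is zero. -/
theorem counit_coextend {X M : Type u} [AddCommGroup M] [Module k M]
    [Module (MonoidAlgebra k G) M] [IsScalarTower k (MonoidAlgebra k G) M]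
    [AddCommGroup X] [Module k X] [Module (MonoidAlgebra k G) X]
    [IsScalarTower k (MonoidAlgebra k G) X] (r : X →ₗ[k] M) (x : X) :
    counit M (coextend (G := G) r x) = ∑ g : G, r.conjugate g x := by
  rw [coextend_apply, map_sum]
  refine Fintype.sum_equiv (Equiv.inv G) _ _ fun g => ?_
  simp [LinearMap.conjugate_apply]

attribute [local instance] ModuleCat.moduleOfAlgebraModule
  ModuleCat.isScalarTower_of_algebra_moduleCat

variable {N : FGModuleCat.{u} (MonoidAlgebra k G)}

/-- A linear endomorphism of `N` with zero norm, whose trace form vanishes on the equivariant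
maps that are not invertible, but not on the identity. -/
theorem exists_trace_separating (hN : ¬ Module.Projective (MonoidAlgebra k G) N)
    (hN' : IsIndecomposable (MonoidAlgebra k G) N) :
    ∃ ρ : N →ₗ[k] N, ∑ g : G, ρ.conjugate g = 0 ∧ LinearMap.trace k N ρ ≠ 0 ∧
      ∀ f : Module.End (MonoidAlgebra k G) N, ¬ IsUnit f →
        LinearMap.trace k N (ρ ∘ₗ f.restrictScalars k) = 0 := by
  have := hN'.1
  -- The non-units of the local ring `End N` form a subspace that misses the identity.
  let J : Submodule k (N →ₗ[k] N) :=
    { carrier := {u | ∃ f : Module.End (MonoidAlgebra k G) N, ¬ IsUnit f ∧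
        f.restrictScalars k = u}
      zero_mem' := ⟨0, not_isUnit_zero, rfl⟩
      add_mem' := by
        rintro _ _ ⟨f, hf, rfl⟩ ⟨g, hg, rfl⟩
        exact ⟨f + g, hN'.not_isUnit_add hf hg, rfl⟩
      smul_mem' := by
        rintro c _ ⟨f, hf, rfl⟩
        refine ⟨c • f, fun h => ?_, rfl⟩
        by_cases hc : c = 0
        · rw [hc, zero_smul] at h
          exact not_isUnit_zero h
        · exact hf ((isUnit_smul_iff (Units.mk0 c hc) f).1 h) }
  have h1 : LinearMap.id ∉ J := by
    rintro ⟨f, hf, h⟩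
    have : f = 1 := LinearMap.restrictScalars_injective k h
    exact hf (this ▸ isUnit_one)
  obtain ⟨μ, hμ, hμJ⟩ := Submodule.exists_le_ker_of_notMem h1
  obtain ⟨ρ, hρ⟩ := exists_trace_comp_eq μ
  refine ⟨ρ, ?_, ?_, fun f hf => (hρ _).trans (hμJ ⟨f, hf, rfl⟩)⟩
  · refine eq_zero_of_trace_comp_eq_zero _ fun u => ?_
    -- The norm of `u` factors through a free module, so it is not a unit and pairs to zero with
    -- `ρ`. By adjointness the norm of `ρ` pairs to zero with every `u`.
    have hnorm : ¬ IsUnit (counit N ∘ₗ coextend u : Module.End (MonoidAlgebra k G) N) := by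
      rintro ⟨v, hv⟩
      refine hN (Module.Projective.of_split (coextend u ∘ₗ (↑v⁻¹ : Module.End _ N)) (counit N) ?_)
      rw [← LinearMap.comp_assoc, ← hv]
      exact v.mul_inv
    have h := (hρ _).trans (hμJ ⟨_, hnorm, rfl⟩)
    have e : ρ ∘ₗ (counit N ∘ₗ coextend (G := G) u).restrictScalars k =
        ∑ g : G, ρ ∘ₗ u.conjugate g := by
      ext x
      rw [LinearMap.sum_apply]
      exact (congrArg ρ (counit_coextend u x)).trans (map_sum ρ _ _)
    have e' : (∑ g : G, ρ.conjugate g) ∘ₗ u = ∑ g : G, ρ.conjugate g ∘ₗ u := by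
      ext x
      simp [LinearMap.sum_apply]
    rw [e, map_sum] at h
    rw [e', map_sum, ← h]
    refine Fintype.sum_equiv (Equiv.inv G) _ _ fun g => ?_
    rw [trace_comp_conjugate]
    simp
  · rw [← LinearMap.comp_id ρ, hρ]
    exact hμ

variable {X : FGModuleCat.{u} (MonoidAlgebra k G)}

/-- The map to `Ω N` that is induced by a linear map to `N` with zero norm. -/
def toOmega (ρ : X →ₗ[k] N) (hρ : ∑ g : G, ρ.conjugate g = 0) :
    X →ₗ[MonoidAlgebra k G] Omega N :=
  (coextend ρ).codRestrict (LinearMap.ker (counit (k := k) (G := G) N)) fun x => by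
    rw [LinearMap.mem_ker, counit_coextend, ← LinearMap.sum_apply, hρ, LinearMap.zero_apply]

theorem inc_toOmega (ρ : X →ₗ[k] N) (hρ : ∑ g : G, ρ.conjugate g = 0) :
    (SES.omega N).inc ∘ₗ toOmega ρ hρ = coextend ρ := rfl

/-- The map `kG ⊗ X ⟶ Y` induced by a linear map `X ⟶ Y`. -/
def extendScalars {Y : Type u} [AddCommGroup Y] [Module k Y] [Module (MonoidAlgebra k G) Y]
    [IsScalarTower k (MonoidAlgebra k G) Y] (w : X →ₗ[k] Y) :
    MonoidAlgebra k G ⊗[k] X →ₗ[MonoidAlgebra k G] Y :=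
  counit Y ∘ₗ AlgebraTensorModule.lTensor _ _ w

theorem extendScalars_unit {Y : Type u} [AddCommGroup Y] [Module k Y]
    [Module (MonoidAlgebra k G) Y] [IsScalarTower k (MonoidAlgebra k G) Y] (w : X →ₗ[k] Y)
    (x : X) : extendScalars w (unit (k := k) (G := G) X x) =
      ∑ g : G, MonoidAlgebra.single g (1 : k) • w (MonoidAlgebra.single g⁻¹ (1 : k) • x) := by
  simp [extendScalars, unit, coextend_apply]

/-- A factorization extends along `unit N` to an equivariant `b` on `kG ⊗ N` with `counit ∘ b = 0`.
With `w_g` the coefficients of `b (1 ⊗ x)`, this says `∑ g ∘ w_g = 0`, while `ρ = ∑ w_g ∘ g`; the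
two sums have the same trace. -/
theorem trace_eq_zero_of_factorsThroughProjective (ρ : N →ₗ[k] N)
    (hρ : ∑ g : G, ρ.conjugate g = 0) (h : FactorsThroughProjective (toOmega ρ hρ)) :
    LinearMap.trace k N ρ = 0 := by
  obtain ⟨P, hP, a, c, hca⟩ := h
  obtain ⟨a', ha'⟩ := exists_extension hP (SES.omegaInv N).inc (SES.omegaInv N).injective a
  let b : MonoidAlgebra k G ⊗[k] N →ₗ[MonoidAlgebra k G] MonoidAlgebra k G ⊗[k] N :=
    (SES.omega N).inc ∘ₗ c ∘ₗ a'
  have hb : b ∘ₗ unit N = coextend ρ := by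
    rw [← inc_toOmega ρ hρ, ← hca, ← ha']
    rfl
  have hb0 : ∀ t, counit N (b t) = 0 := fun t => (SES.omega N).proj_inc _
  let w : N →ₗ[k] MonoidAlgebra k G ⊗[k] N :=
    b.restrictScalars k ∘ₗ TensorProduct.mk k (MonoidAlgebra k G) N 1
  have hbw : ∀ (g : G) (x : N), b (MonoidAlgebra.single g (1 : k) ⊗ₜ x)
      = MonoidAlgebra.single g (1 : k) • w x := by
    intro g x
    change _ = _ • b (1 ⊗ₜ x)
    rw [← map_smul, smul_tmul', smul_eq_mul, mul_one]
  have hsum : ρ = ∑ g : G, (tensorCoeff g ∘ₗ w) ∘ₗ MonoidAlgebra.GroupSMul.linearMap k N g := by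
    ext x
    have h1 : tensorCoeff (1 : G) (coextend ρ x) = ρ x := by
      rw [tensorCoeff_coextend, inv_one, ← MonoidAlgebra.one_def, one_smul]
    have h2 : b (unit N x) = coextend ρ x := LinearMap.congr_fun hb x
    rw [← h1, ← h2, unit, coextend_apply, map_sum, map_sum, LinearMap.sum_apply]
    refine Fintype.sum_equiv (Equiv.inv G) _ _ fun g => ?_
    rw [hbw, tensorCoeff_smul]
    simp [MonoidAlgebra.GroupSMul.linearMap_apply]
  have hsum0 : ∑ g : G, MonoidAlgebra.GroupSMul.linearMap k N g ∘ₗ (tensorCoeff g ∘ₗ w) = 0 := by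
    ext x
    rw [LinearMap.sum_apply]
    exact (counit_eq_sum (w x)).symm.trans (hb0 _)
  rw [hsum, map_sum, ← map_zero (LinearMap.trace k N), ← hsum0, map_sum]
  exact Finset.sum_congr rfl fun g _ => LinearMap.trace_comp_comm' _ _

/-- Orthogonality gives `ρ = ∑ (w h).conjugate h` with `∑ w h = 0`. The second identity puts `v x =
∑ h ⊗ h⁻¹ (w h x)` in `Ω N`; the first shows that its equivariant extension to `kG ⊗ X`, composed
with `unit X`, is `coextend ρ`. -/
theorem factorsThroughProjective_toOmega (ρ : X →ₗ[k] N) (hρ : ∑ g : G, ρ.conjugate g = 0)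
    (h : ∀ g : N →ₗ[MonoidAlgebra k G] X, LinearMap.trace k X (g.restrictScalars k ∘ₗ ρ) = 0) :
    FactorsThroughProjective (toOmega ρ hρ) := by
  obtain ⟨w, hw0, hw⟩ := exists_sum_conjugate_of_trace_eq_zero ρ h
  let v : X →ₗ[k] MonoidAlgebra k G ⊗[k] N :=
    ∑ g : G, TensorProduct.mk k (MonoidAlgebra k G) N (MonoidAlgebra.single g 1) ∘ₗ
      MonoidAlgebra.GroupSMul.linearMap k N g⁻¹ ∘ₗ w g
  have hv : ∀ x, counit N (v x) = 0 := by
    intro x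
    have : counit N (v x) = (∑ g : G, w g) x := by
      simp [v, LinearMap.sum_apply, MonoidAlgebra.GroupSMul.linearMap_apply, ← mul_smul,
        MonoidAlgebra.single_mul_single, ← MonoidAlgebra.one_def]
    rw [this, hw0, LinearMap.zero_apply]
  have hext : ∀ t, counit N (extendScalars v t) = 0 := by
    intro t
    induction t with
    | zero => simp
    | add a b ha hb => rw [map_add, map_add, ha, hb, add_zero]
    | tmul a x =>
      have : extendScalars v (a ⊗ₜ x) = a • v x := rfl
      rw [this, map_smul, hv, smul_zero]
  refine ⟨(SES.omegaInv X).B, SES.projective_omegaInv X, (SES.omegaInv X).inc,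
    (extendScalars v).codRestrict (LinearMap.ker (counit (k := k) (G := G) N)) hext, ?_⟩
  refine LinearMap.ext fun x => Subtype.ext ?_
  change extendScalars v (unit X x) = coextend ρ x
  rw [extendScalars_unit, coextend_apply]
  have hv' : ∀ y, v y = ∑ h : G, MonoidAlgebra.single h (1 : k) ⊗ₜ[k]
      (MonoidAlgebra.single h⁻¹ (1 : k) • w h y) := fun y => by
    simp [v, LinearMap.sum_apply, MonoidAlgebra.GroupSMul.linearMap_apply]
  simp only [hv', Finset.smul_sum, smul_tmul', smul_eq_mul, MonoidAlgebra.single_mul_single,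
    mul_one, ← hw, LinearMap.sum_apply, tmul_sum, LinearMap.conjugate_apply, ← mul_smul]
  -- For fixed `h`, the substitution `g ↦ g * h` matches the two sums over `G`.
  refine Finset.sum_comm.trans (Eq.trans ?_ Finset.sum_comm)
  refine Finset.sum_congr rfl fun h _ => ?_
  refine Fintype.sum_equiv (Equiv.mulRight h) _ _ fun g => ?_
  simp

end AlmostVanishing

/-! ### Existence of almost split sequences -/

section Existence

attribute [local instance] ModuleCat.moduleOfAlgebraModule
  ModuleCat.isScalarTower_of_algebra_moduleCat

variable {N : FGModuleCat.{u} (MonoidAlgebra k G)}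

/-- There is a map `N ⟶ Ω N` that is not stably zero, but becomes stably zero after composition
with any map to `N` that is not a split epimorphism. -/
theorem exists_almostVanishing (hN : ¬ Module.Projective (MonoidAlgebra k G) N)
    (hN' : IsIndecomposable (MonoidAlgebra k G) N) :
    ∃ δ : N →ₗ[MonoidAlgebra k G] Omega N, ¬ FactorsThroughProjective δ ∧
      ∀ (X : FGModuleCat.{u} (MonoidAlgebra k G)) (f : X →ₗ[MonoidAlgebra k G] N),
        (¬ ∃ s : N →ₗ[MonoidAlgebra k G] X, f ∘ₗ s = LinearMap.id) →
          FactorsThroughProjective (δ ∘ₗ f) := by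
  obtain ⟨ρ, hρ, hρ1, hρf⟩ := exists_trace_separating hN hN'
  refine ⟨toOmega ρ hρ, fun h => hρ1 (trace_eq_zero_of_factorsThroughProjective ρ hρ h),
    fun X f hf => ?_⟩
  have hconj : ∀ g : G, (ρ ∘ₗ f.restrictScalars k).conjugate g
      = ρ.conjugate g ∘ₗ f.restrictScalars k := by
    intro g
    ext x
    simp [LinearMap.conjugate_apply]
  have hρ' : ∑ g : G, (ρ ∘ₗ f.restrictScalars k).conjugate g = 0 := by
    ext x
    have := LinearMap.congr_fun hρ (f x)
    simpa [hconj, LinearMap.sum_apply] using this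
  have hcomp : toOmega ρ hρ ∘ₗ f = toOmega (ρ ∘ₗ f.restrictScalars k) hρ' := by
    refine LinearMap.ext fun x => Subtype.ext ?_
    change coextend ρ (f x) = coextend (ρ ∘ₗ f.restrictScalars k) x
    simp [coextend_apply]
  rw [hcomp]
  refine factorsThroughProjective_toOmega _ _ fun g => ?_
  -- By cyclicity the trace is that of `ρ ∘ (f ∘ g)`, and `f ∘ g` can be a unit only if `f` is a
  -- split epimorphism.
  rw [LinearMap.trace_comp_comm']
  refine hρf (f ∘ₗ g) ?_
  rintro ⟨v, hv⟩
  refine hf ⟨g ∘ₗ (↑v⁻¹ : Module.End _ N), ?_⟩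
  rw [← LinearMap.comp_assoc, ← hv]
  exact v.mul_inv

/-- The pullback of a short exact sequence. -/
def SES.pullback {R : Type u} [Ring R] [IsNoetherianRing R] {C D : FGModuleCat.{u} R} (E : SES C)
    (δ : D →ₗ[R] C) : SES D where
  A := E.A
  B := FGModuleCat.of R (LinearMap.eqLocus (E.proj ∘ₗ LinearMap.fst R E.B D)
    (δ ∘ₗ LinearMap.snd R E.B D))
  inc := (LinearMap.inl R E.B D ∘ₗ E.inc).codRestrict _ fun a => by
    simp [LinearMap.mem_eqLocus, E.proj_inc]
  proj := LinearMap.snd R E.B D ∘ₗ Submodule.subtype _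
  injective := fun x y h => E.injective (congrArg (fun t => t.1.1) h)
  exact := by
    rintro ⟨⟨b, d⟩, h⟩
    constructor
    · intro (hd : d = 0)
      subst hd
      have hb : E.proj b = 0 := h.trans (map_zero δ)
      obtain ⟨a, rfl⟩ := (E.exact b).1 hb
      exact ⟨a, rfl⟩
    · rintro ⟨a, ha⟩
      exact (congrArg (fun t => t.1.2) ha).symm
  surjective := fun d => by
    obtain ⟨b, hb⟩ := E.surjective (δ d)
    exact ⟨⟨(b, d), hb⟩, rfl⟩

/-- A map lifts to the pullback if its composition with `δ` lifts to the middle term. -/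
theorem SES.exists_lift_pullback_iff {R : Type u} [Ring R] [IsNoetherianRing R]
    {C D X : FGModuleCat.{u} R} (E : SES C) (δ : D →ₗ[R] C) (f : X →ₗ[R] D) :
    (∃ g : X →ₗ[R] (E.pullback δ).B, (E.pullback δ).proj ∘ₗ g = f) ↔
      ∃ h : X →ₗ[R] E.B, E.proj ∘ₗ h = δ ∘ₗ f := by
  constructor
  · rintro ⟨g, rfl⟩
    exact ⟨LinearMap.fst R E.B D ∘ₗ Submodule.subtype _ ∘ₗ g, LinearMap.ext fun x => (g x).2⟩
  · rintro ⟨h, hh⟩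
    exact ⟨(h.prod f).codRestrict _ (LinearMap.congr_fun hh), rfl⟩

/-- A map `f` lifts to the pullback along `δ` iff `δ ∘ f` lifts to the projective `E.B`, that is,
iff `δ ∘ f` is stably zero. Taking `f = id` gives non-splitness, and the other `f` give the lifting
property. -/
theorem exists_isAlmostSplitConnecting (hN : ¬ Module.Projective (MonoidAlgebra k G) N)
    (hN' : IsIndecomposable (MonoidAlgebra k G) N) : ∃ φ, IsAlmostSplitConnecting N φ := by
  obtain ⟨δ, hδ, hδf⟩ := exists_almostVanishing hN hN'
  have hΩ : ¬ Module.Projective (MonoidAlgebra k G) (Omega N) := fun h =>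
    hδ ⟨_, h, δ, LinearMap.id, rfl⟩
  obtain ⟨E, hE, hA⟩ := exists_indecomposable_syzygy hΩ
    (SES.stablyConnected_left (SES.projective_omega N) hN'.stablyConnected)
  obtain ⟨ψ⟩ := E.nonempty_iso_omegaInv hE
  -- Any stable isomorphism `ψ` will do: `φ` is taken to be the connecting map followed by `ψ`, with
  -- no need to compare it with `δ`.
  refine ⟨_, E.pullback δ, ⟨hA, hN', fun h => hδ ?_, fun X f hf => ?_⟩, ψ, rfl⟩
  · obtain ⟨t, ht⟩ := (E.exists_lift_pullback_iff δ LinearMap.id).1 h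
    exact ⟨E.B, hE, t, E.proj, ht⟩
  · exact (E.exists_lift_pullback_iff δ f).2 ((hδf X f hf).exists_lift E.proj E.surjective)

end Existence

end StableModule

end

theorem theorem2p1 {k G : Type u} [Field k] [Group G] [Fintype G]
    (M N : FGModuleCat.{u} (MonoidAlgebra k G))
    (hM : ¬ Module.Projective (MonoidAlgebra k G) M)
    (hM' : StableModule.IsIndecomposable (MonoidAlgebra k G) M)
    (hN : ¬ Module.Projective (MonoidAlgebra k G) N)
    (hN' : StableModule.IsIndecomposable (MonoidAlgebra k G) N)
    (hMN : ∀ i : ℤ, IsEmpty ((StableModule.toStMod (MonoidAlgebra k G)).obj N ≅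
      (StableModule.toStMod (MonoidAlgebra k G)).obj (StableModule.OmegaPow i M))) :
    (∃ φ, StableModule.IsAlmostSplitConnecting N φ) ∧
    ∀ φ, StableModule.IsAlmostSplitConnecting N φ →
      φ ≠ 0 ∧ ∀ i : ℤ, StableModule.TateExt.map i M φ = 0 :=
  ⟨StableModule.exists_isAlmostSplitConnecting hN hN', fun _ hφ => ⟨hφ.ne_zero, fun i =>
    AddMonoidHom.ext fun f => hφ.comp_eq_zero hN
      (StableModule.stablyConnected_omegaPow hM'.stablyConnected i) (hMN i) f⟩⟩
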